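/- For $\alpha\in\mathbb{R}$ let $A_\alpha$ be the universal $C^*$-algebra generated by two unitaries $u,v$ with $uv=e^{2\pi i\alpha}vu$, and let $H_\alpha=u+u^*+v+v^*\in A_\alpha$. For $z\in\mathbb{C}$ and $\operatorname{Im}\tau>0$ put $$\vartheta(z,\tau)=\sum_{m\in\mathbb{Z}}e^{\pi i m^2\tau+2\pi i m z},\qquad \vartheta^{odd}(z,\tau)=\sum_{m\in\mathbb{Z},\ m\text{ odd}}e^{\pi i m^2\tau+2\pi i m z}.$$ Let $q\ge 2$ be an integer. (i) If $q$ is even, then $\vartheta(0,\frac{iq}{2})\neq 0$, $\vartheta(0,\frac{2i}{q})\neq 0$, and $$\|H_{1/q}\|\ \ge\ 4e^{-\frac{\pi}{2q}}\,\frac{\vartheta(\frac i2,\frac{iq}{2})\,\vartheta(\frac12,\frac{iq}{2})}{\vartheta(0,\frac{iq}{2})^2}\ =\ 4\,\frac{\vartheta(\frac1q,\frac{2i}{q})\,\vartheta(\frac12,\frac{iq}{2})}{\vartheta(0,\frac{2i}{q})\,\vartheta(0,\frac{iq}{2})},$$ the quotient being a real number. (ii) If $q$ is odd, then $\vartheta(0,\frac{iq}{2})^2-2\,\vartheta^{odd}(0,\frac{iq}{2})^2\neq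 0$, and $$\|H_{1/q}\|\ \ge\ 4e^{-\frac{\pi}{2q}}\,\frac{\vartheta(\frac i2,\frac{iq}{2})\,\vartheta(\frac12,\frac{iq}{2})-2\,\vartheta^{odd}(\frac i2,\frac{iq}{2})\,\vartheta^{odd}(\frac12,\frac{iq}{2})}{\vartheta(0,\frac{iq}{2})^2-2\,\vartheta^{odd}(0,\frac{iq}{2})^2},$$ the quotient being a real number. (iii) For $q=2$ the inequality in (i) is an equality. -/

import Mathlib

open scoped ENNReal

/-- `U` and `V` are unitaries of the unital C⋆-algebra `B` with `U V = e^{2π i α} V U`. -/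
structure IsRotationPair (α : ℝ) {B : Type*} [CStarAlgebra B] (U V : B) : Prop where
  left_mem : U ∈ unitary B
  right_mem : V ∈ unitary B
  mul_eq : U * V = Complex.exp (2 * Real.pi * Complex.I * α) • (V * U)

/-- A nonzero C⋆-algebra together with two unitaries satisfying the rotation relation. -/
structure RotationRep (α : ℝ) : Type 1 where
  carrier : Type
  [cstar : CStarAlgebra carrier]
  [nontrivial : Nontrivial carrier]
  fst : carrier
  snd : carrier
  isRotationPair : IsRotationPair α fst snd

attribute [instance] RotationRep.cstar RotationRep.nontrivial

/-- The C⋆-algebra of all bounded families indexed by the rotation pairs. -/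
abbrev RotationProduct (α : ℝ) : Type 1 := lp (fun π : RotationRep α => π.carrier) ∞

noncomputable instance RotationProduct.instCStarAlgebra (α : ℝ) :
    CStarAlgebra (RotationProduct α) where

/-- The universal pair of unitaries: the family of all rotation pairs. -/
noncomputable def RotationProduct.fst (α : ℝ) : RotationProduct α :=
  ⟨fun π => π.fst, memℓp_infty ⟨1, by
    rintro _ ⟨π, rfl⟩
    exact (CStarRing.norm_of_mem_unitary π.isRotationPair.left_mem).le⟩⟩

noncomputable def RotationProduct.snd (α : ℝ) : RotationProduct α :=
  ⟨fun π => π.snd, memℓp_infty ⟨1, by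
    rintro _ ⟨π, rfl⟩
    exact (CStarRing.norm_of_mem_unitary π.isRotationPair.right_mem).le⟩⟩

noncomputable def rotationSubalgebra (α : ℝ) : StarSubalgebra ℂ (RotationProduct α) :=
  (StarAlgebra.adjoin ℂ {RotationProduct.fst α, RotationProduct.snd α}).topologicalClosure

/-- The rotation algebra `A_α`: the universal (unital) C⋆-algebra generated by two unitaries `u`, `v`
with `u v = e^{2π i α} v u`, realised as the closed star subalgebra generated by the family of all
such pairs (its universal property is `RotationAlgebra.existsUnique_lift` below). -/
def RotationAlgebra (α : ℝ) : Type 1 := rotationSubalgebra α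

instance rotationSubalgebra.isClosed (α : ℝ) :
    IsClosed (rotationSubalgebra α : Set (RotationProduct α)) :=
  StarSubalgebra.isClosed_topologicalClosure _

noncomputable instance RotationAlgebra.instCStarAlgebra (α : ℝ) :
    CStarAlgebra (RotationAlgebra α) :=
  StarSubalgebra.cstarAlgebra (rotationSubalgebra α)

namespace RotationAlgebra

/-- The canonical generator `u` of `A_α`. -/
noncomputable def u (α : ℝ) : RotationAlgebra α :=
  ⟨RotationProduct.fst α, StarSubalgebra.le_topologicalClosure _
    (StarAlgebra.subset_adjoin ℂ _ (by simp))⟩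

/-- The canonical generator `v` of `A_α`. -/
noncomputable def v (α : ℝ) : RotationAlgebra α :=
  ⟨RotationProduct.snd α, StarSubalgebra.le_topologicalClosure _
    (StarAlgebra.subset_adjoin ℂ _ (by simp))⟩

theorem isRotationPair (α : ℝ) : IsRotationPair α (u α) (v α) := by
  refine ⟨⟨?_, ?_⟩, ⟨?_, ?_⟩, ?_⟩
  · exact Subtype.ext (Subtype.ext (funext fun π => π.isRotationPair.left_mem.1))
  · exact Subtype.ext (Subtype.ext (funext fun π => π.isRotationPair.left_mem.2))
  · exact Subtype.ext (Subtype.ext (funext fun π => π.isRotationPair.right_mem.1))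
  · exact Subtype.ext (Subtype.ext (funext fun π => π.isRotationPair.right_mem.2))
  · exact Subtype.ext (Subtype.ext (funext fun π => π.isRotationPair.mul_eq))

/-- The coordinate projection of `A_α` onto the member `π` of the family. -/
noncomputable def proj {α : ℝ} (π : RotationRep α) : RotationAlgebra α →⋆ₐ[ℂ] π.carrier where
  toFun a := a.1 π
  map_one' := rfl
  map_mul' _ _ := rfl
  map_zero' := rfl
  map_add' _ _ := rfl
  commutes' _ := rfl
  map_star' _ := rfl

theorem proj_u {α : ℝ} (π : RotationRep α) : proj π (u α) = π.fst := rfl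
theorem proj_v {α : ℝ} (π : RotationRep α) : proj π (v α) = π.snd := rfl

/-- A unital star homomorphism out of `A_α` is determined by its values at `u` and `v`. -/
theorem hom_ext {α : ℝ} {B : Type*} [CStarAlgebra B] {φ ψ : RotationAlgebra α →⋆ₐ[ℂ] B}
    (hu : φ (u α) = ψ (u α)) (hv : φ (v α) = ψ (v α)) : φ = ψ := by
  have hφ : Continuous φ := AddMonoidHomClass.continuous_of_bound φ 1 fun a => by
    simpa using NonUnitalStarAlgHom.norm_apply_le φ a
  have hψ : Continuous ψ := AddMonoidHomClass.continuous_of_bound ψ 1 fun a => by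
    simpa using NonUnitalStarAlgHom.norm_apply_le ψ a
  let ι : RotationAlgebra α →⋆ₐ[ℂ] RotationProduct α := (rotationSubalgebra α).subtype
  have hι : Isometry ι := isometry_subtype_coe
  have key : ∀ x ∈ StarAlgebra.adjoin ℂ {RotationProduct.fst α, RotationProduct.snd α},
      ∃ a : RotationAlgebra α, ι a = x ∧ φ a = ψ a := by
    intro x hx
    induction hx using StarAlgebra.adjoin_induction with
    | mem x h =>
      rcases h with h | h
      · exact ⟨u α, h.symm, hu⟩
      · exact ⟨v α, h.symm, hv⟩
    | algebraMap r => exact ⟨algebraMap ℂ _ r, AlgHomClass.commutes ι r, by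
        rw [AlgHomClass.commutes, AlgHomClass.commutes]⟩
    | add x y _ _ hx hy =>
      obtain ⟨a, rfl, ha⟩ := hx
      obtain ⟨b, rfl, hb⟩ := hy
      exact ⟨a + b, map_add ι a b, by rw [map_add, map_add, ha, hb]⟩
    | mul x y _ _ hx hy =>
      obtain ⟨a, rfl, ha⟩ := hx
      obtain ⟨b, rfl, hb⟩ := hy
      exact ⟨a * b, map_mul ι a b, by rw [map_mul, map_mul, ha, hb]⟩
    | star x _ hx =>
      obtain ⟨a, rfl, ha⟩ := hx
      exact ⟨star a, map_star ι a, by rw [map_star, map_star, ha]⟩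
  ext a
  have ha : ι a ∈ closure (StarAlgebra.adjoin ℂ
      {RotationProduct.fst α, RotationProduct.snd α} : Set (RotationProduct α)) := a.2
  refine (isClosed_eq hφ hψ).closure_subset (s := {x | φ x = ψ x}) ?_
  rw [hι.isEmbedding.isInducing.closure_eq_preimage_closure_image]
  refine closure_mono ?_ ha
  intro x hx
  obtain ⟨b, hb, hb'⟩ := key x hx
  exact ⟨b, hb', hb⟩

/-- A star subalgebra generated by two elements, and its closure, are small. -/
theorem small_closure_adjoin {B : Type*} [CStarAlgebra B] (U V : B) :
    Small.{0} (StarAlgebra.adjoin ℂ ({U, V} : Set B)).topologicalClosure := by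
  have hs : Small.{0} (Algebra.adjoin ℂ (({U, V} : Set B) ∪ star {U, V})) := by
    have hr : (({U, V} : Set B) ∪ star {U, V}) = Set.range ![U, V, star U, star V] := by
      ext x
      simp only [Set.mem_union, Set.mem_insert_iff, Set.mem_singleton_iff, Set.mem_star,
        Set.mem_range, Fin.exists_fin_succ, Fin.exists_fin_zero, star_eq_iff_star_eq]
      simp [eq_comm, or_assoc]
    rw [hr, Algebra.adjoin_range_eq_range_freeAlgebra_lift]
    exact small_range _
  let D : Set B := (StarAlgebra.adjoin ℂ ({U, V} : Set B) : Set B)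
  have hD : Small.{0} D := hs
  refine small_of_injective (β := D → ℝ)
    (f := fun x d => dist (x : B) (d : B)) ?_
  intro x y hxy
  have hx : (x : B) ∈ closure D := x.2
  apply Subtype.ext
  apply eq_of_forall_dist_le
  intro ε hε
  obtain ⟨d, hd, hdx⟩ := Metric.mem_closure_iff.1 hx (ε / 2) (half_pos hε)
  have hy : dist (x : B) d = dist (y : B) d := congrFun hxy ⟨d, hd⟩
  have := dist_triangle_right (x : B) (y : B) d
  linarith

/-- A small C⋆-algebra has a copy in the lowest universe. -/
theorem exists_small_copy (B : Type*) [CStarAlgebra B] [Small.{0} B] :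
    ∃ (B' : Type) (_ : CStarAlgebra B'), Nonempty (B' ≃⋆ₐ[ℂ] B) := by
  let e : Shrink.{0} B ≃ₐ[ℂ] B := Shrink.algEquiv ℂ B
  let _ : Star (Shrink.{0} B) := ⟨fun x => e.symm (star (e x))⟩
  have he : ∀ x, e (star x) = star (e x) := fun x => e.apply_symm_apply _
  let _ : NormedRing (Shrink.{0} B) := NormedRing.induced _ _ e e.injective
  let _ : StarRing (Shrink.{0} B) :=
    { star_involutive := fun x => e.injective (by simp only [he, star_star])
      star_mul := fun x y => e.injective (by simp only [he, map_mul, star_mul])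
      star_add := fun x y => e.injective (by simp only [he, map_add, star_add]) }
  let _ : NormedAlgebra ℂ (Shrink.{0} B) :=
    { (inferInstance : Algebra ℂ (Shrink.{0} B)) with
      norm_smul_le := fun r x => by
        change ‖e (r • x)‖ ≤ ‖r‖ * ‖e x‖
        rw [map_smul]
        exact norm_smul_le _ _ }
  have hiso : Isometry e := Isometry.of_dist_eq fun _ _ => rfl
  have : CompleteSpace (Shrink.{0} B) :=
    (IsometryEquiv.mk e.toEquiv hiso).completeSpace
  have : CStarRing (Shrink.{0} B) :=
    ⟨fun x => by
      change ‖e x‖ * ‖e x‖ ≤ ‖e (star x * x)‖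
      rw [map_mul, he]
      exact CStarRing.norm_mul_self_le _⟩
  have : StarModule ℂ (Shrink.{0} B) :=
    ⟨fun r x => e.injective (by simp only [he, map_smul, star_smul])⟩
  exact ⟨Shrink.{0} B, { }, ⟨StarAlgEquiv.ofAlgEquiv e he⟩⟩

/-- The universal property of `A_α`. -/
theorem existsUnique_lift (α : ℝ) {B : Type*} [CStarAlgebra B] {U V : B}
    (h : IsRotationPair α U V) :
    ∃! φ : RotationAlgebra α →⋆ₐ[ℂ] B, φ (u α) = U ∧ φ (v α) = V := by
  suffices hex : ∃ φ : RotationAlgebra α →⋆ₐ[ℂ] B, φ (u α) = U ∧ φ (v α) = V by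
    obtain ⟨φ, hφ⟩ := hex
    exact ⟨φ, hφ, fun ψ hψ => hom_ext (hψ.1.trans hφ.1.symm) (hψ.2.trans hφ.2.symm)⟩
  rcases subsingleton_or_nontrivial B with hB | hB
  · exact ⟨{ toFun := fun _ => 0
             map_one' := Subsingleton.elim _ _
             map_mul' := fun _ _ => Subsingleton.elim _ _
             map_zero' := Subsingleton.elim _ _
             map_add' := fun _ _ => Subsingleton.elim _ _
             commutes' := fun _ => Subsingleton.elim _ _
             map_star' := fun _ => Subsingleton.elim _ _ },
      Subsingleton.elim _ _, Subsingleton.elim _ _⟩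
  let C := (StarAlgebra.adjoin ℂ ({U, V} : Set B)).topologicalClosure
  have : IsClosed (C : Set B) := StarSubalgebra.isClosed_topologicalClosure _
  let _ : CStarAlgebra C := StarSubalgebra.cstarAlgebra C
  have : Small.{0} C := small_closure_adjoin U V
  obtain ⟨B', _, ⟨e⟩⟩ := exists_small_copy C
  let U' : C := ⟨U, StarSubalgebra.le_topologicalClosure _
    (StarAlgebra.subset_adjoin ℂ _ (by simp))⟩
  let V' : C := ⟨V, StarSubalgebra.le_topologicalClosure _
    (StarAlgebra.subset_adjoin ℂ _ (by simp))⟩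
  have : Nontrivial B' := e.symm.injective.nontrivial
  let π : RotationRep α :=
    { carrier := B'
      fst := e.symm U'
      snd := e.symm V'
      isRotationPair := by
        refine ⟨⟨?_, ?_⟩, ⟨?_, ?_⟩, ?_⟩
        · rw [← map_star, ← map_mul, ← map_one e.symm]
          exact congrArg e.symm (Subtype.ext h.left_mem.1)
        · rw [← map_star, ← map_mul, ← map_one e.symm]
          exact congrArg e.symm (Subtype.ext h.left_mem.2)
        · rw [← map_star, ← map_mul, ← map_one e.symm]
          exact congrArg e.symm (Subtype.ext h.right_mem.1)
        · rw [← map_star, ← map_mul, ← map_one e.symm]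
          exact congrArg e.symm (Subtype.ext h.right_mem.2)
        · rw [← map_mul, ← map_mul, ← map_smul]
          exact congrArg e.symm (Subtype.ext h.mul_eq) }
  refine ⟨C.subtype.comp ((e : B' →⋆ₐ[ℂ] C).comp (proj π)), ?_, ?_⟩
  · change ((e (e.symm U') : C) : B) = U
    rw [e.apply_symm_apply]
  · change ((e (e.symm V') : C) : B) = V
    rw [e.apply_symm_apply]

end RotationAlgebra

/-- The element `H_α = u + u^* + v + v^*` of `A_α`. -/
noncomputable def hofstadter (α : ℝ) : RotationAlgebra α :=
  RotationAlgebra.u α + star (RotationAlgebra.u α)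
    + RotationAlgebra.v α + star (RotationAlgebra.v α)

/-- The series `ϑ^{odd}(z, τ) = ∑_{m odd} e^{π i m² τ + 2π i m z}`. The full theta series
`ϑ(z, τ) = ∑_m e^{π i m² τ + 2π i m z}` is Mathlib's `jacobiTheta₂ z τ`. -/
noncomputable def thetaOdd (z τ : ℂ) : ℂ :=
  ∑' m : {m : ℤ // Odd m}, Complex.exp (Real.pi * Complex.I * (m : ℤ) ^ 2 * τ
    + 2 * Real.pi * Complex.I * (m : ℤ) * z)

/-- The quotient `4 e^{-π/(2q)} ϑ(i/2, iq/2) ϑ(1/2, iq/2) / ϑ(0, iq/2)^2`. -/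
noncomputable def thetaQuotientEven (q : ℕ) : ℂ :=
  4 * Complex.exp (-(Real.pi / (2 * q)))
    * (jacobiTheta₂ (Complex.I / 2) (Complex.I * q / 2) * jacobiTheta₂ (1 / 2) (Complex.I * q / 2))
    / jacobiTheta₂ 0 (Complex.I * q / 2) ^ 2

/-- The quotient `4 e^{-π/(2q)} (ϑ(i/2, iq/2) ϑ(1/2, iq/2) - 2 ϑ^{odd}(i/2, iq/2) ϑ^{odd}(1/2, iq/2))
/ (ϑ(0, iq/2)^2 - 2 ϑ^{odd}(0, iq/2)^2)`. -/
noncomputable def thetaQuotientOdd (q : ℕ) : ℂ :=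
  4 * Complex.exp (-(Real.pi / (2 * q)))
    * (jacobiTheta₂ (Complex.I / 2) (Complex.I * q / 2) * jacobiTheta₂ (1 / 2) (Complex.I * q / 2)
      - 2 * (thetaOdd (Complex.I / 2) (Complex.I * q / 2) * thetaOdd (1 / 2) (Complex.I * q / 2)))
    / (jacobiTheta₂ 0 (Complex.I * q / 2) ^ 2 - 2 * thetaOdd 0 (Complex.I * q / 2) ^ 2)

/-! The lower bound is a variational estimate. The cyclic shift and the clock operator on `ℓ²(ℤ/q)`
represent the rotation relation for `1/q`, and star homomorphisms are contractive, so `‖H‖`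
dominates the Rayleigh quotient of `U + U* + V + V*` at any nonzero vector
(`two_mul_re_inner_le_norm_hofstadter`). The test vector is the periodized Gaussian, which is fixed
by the discrete Fourier transform up to scale; accordingly shift and clock have the same
expectation, the autocorrelation at lag 1, and the quotient is `4 c₁ / c₀`.

`sum_periodicGaussian_mul` evaluates these correlations: unfolding the periodization leaves a sum
over `ℤ × ℤ`, whose inner sum is a theta value at `2i/q`, moved to `iq/2` by the modular
transformation. The outer sum shifts the argument by `m q / 2`, which is where the parity of `q`
enters. Reality and nonvanishing follow from `c₀` and `c₁` being sums of positive reals.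

For `q = 2` the generators anticommute, giving `‖H‖² ≤ 8`, and `c₀² = 2 c₁²` makes the lower bound
equal to `√8`. -/

theorem tsum_int_eq_sum_fin {q : ℕ} [NeZero q] {F : ℤ → ℂ} (hF : Summable F) :
    ∑' a, F a = ∑ j : Fin q, ∑' k : ℤ, F ((j : ℕ) + k * q) := by
  let e : Fin q × ℤ ≃ ℤ := (Equiv.prodComm _ _).trans (Int.divModEquiv q).symm
  have he (p : Fin q × ℤ) : e p = (p.1 : ℕ) + p.2 * q := add_comm _ _
  have hs : Summable fun p : Fin q × ℤ => F ((p.1 : ℕ) + p.2 * q) :=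
    (e.summable_iff.2 hF).congr fun p => congrArg F (he p)
  rw [← e.tsum_eq F, ← tsum_fintype (L := .unconditional _), ← hs.tsum_prod]
  exact tsum_congr fun p => congrArg F (he p)

/-! ### Periodized Gaussians -/

/-- The Gaussian `e^{-π x² / q}` on the integers. -/
noncomputable def intGaussian (q : ℕ) (x : ℤ) : ℝ := Real.exp (-(Real.pi * x ^ 2 / q))

/-- The `q`-periodic vector `a ↦ ∑_k e^{-π (a + k q)² / q}`. -/
noncomputable def periodicGaussian (q : ℕ) (a : ℤ) : ℝ := ∑' k : ℤ, intGaussian q (a + k * q)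

section

variable {q : ℕ} (hq : 0 < q)

include hq

theorem im_I_mul_div_two_pos : 0 < (Complex.I * q / 2).im := by
  have : (0 : ℝ) < q := by exact_mod_cast hq
  simpa using this

theorem summable_intGaussian : Summable (intGaussian q) := by
  have h0 : (0 : ℝ) < q := by exact_mod_cast hq
  have hτ : 0 < (Complex.I / q).im := by
    simpa [Complex.div_im] using div_pos h0 (mul_pos h0 h0)
  have h := ((summable_jacobiTheta₂_term_iff 0 (Complex.I / q)).2 hτ).norm
  refine h.congr fun n => ?_
  rw [norm_jacobiTheta₂_term, intGaussian]
  congr 1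
  simp [Complex.div_im]
  field_simp

theorem summable_intGaussian_shift (a : ℤ) : Summable fun k : ℤ => intGaussian q (a + k * q) :=
  (summable_intGaussian hq).comp_injective fun k l h => by
    simpa [hq.ne'] using h

theorem periodicGaussian_pos (a : ℤ) : 0 < periodicGaussian q a :=
  (summable_intGaussian_shift hq a).tsum_pos (fun _ => (Real.exp_pos _).le) 0 (Real.exp_pos _)

omit hq in
theorem periodicGaussian_add (a k : ℤ) :
    periodicGaussian q (a + k * q) = periodicGaussian q a := by
  rw [periodicGaussian, periodicGaussian,
    ← (Equiv.addLeft k).tsum_eq fun l => intGaussian q (a + l * q)]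
  exact tsum_congr fun l => congrArg _ (by simp only [Equiv.coe_addLeft]; ring)

/-- The family is the restriction of a product of two summable families along an injection of `ℤ ×
ℤ`. -/
theorem summable_intGaussian_mul (s : ℤ) :
    Summable fun p : ℤ × ℤ => intGaussian q p.1 * intGaussian q (p.1 + s + p.2 * q) := by
  have h := (summable_intGaussian hq).mul_of_nonneg (summable_intGaussian hq)
    (fun _ => (Real.exp_pos _).le) (fun _ => (Real.exp_pos _).le)
  refine h.comp_injective (i := fun p : ℤ × ℤ => (p.1, p.1 + s + p.2 * q)) ?_
  rintro ⟨a, k⟩ ⟨b, l⟩ hab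
  simp only [Prod.mk.injEq] at hab
  obtain ⟨rfl, h⟩ := hab
  simpa [hq.ne'] using h

end

/-! ### Double theta series and the parity of `q` -/

/-- The double theta series `∑_m e^{π i m² τ + 2π i m w} ϑ(z + m q / 2, τ)` at `τ = i q / 2`. -/
noncomputable def thetaPair (q : ℕ) (w z : ℂ) : ℂ :=
  ∑' m : ℤ, jacobiTheta₂_term m w (Complex.I * q / 2)
    * jacobiTheta₂ (z + m * q / 2) (Complex.I * q / 2)

theorem jacobiTheta₂_add_int (z τ : ℂ) (n : ℤ) : jacobiTheta₂ (z + n) τ = jacobiTheta₂ z τ := by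
  induction n with
  | zero => simp
  | succ n ih =>
    rw [← ih, ← jacobiTheta₂_add_left (z + (n : ℤ))]
    push_cast
    rw [add_assoc]
  | pred n ih =>
    rw [← ih, ← jacobiTheta₂_add_left]
    push_cast
    ring_nf

theorem thetaOdd_eq_tsum (z τ : ℂ) :
    thetaOdd z τ = ∑' m : ℤ, if Odd m then jacobiTheta₂_term m z τ else 0 := by
  rw [thetaOdd, ← tsum_subtype_eq_of_support_subset (s := {m : ℤ | Odd m})]
  · refine tsum_congr fun m => ?_
    rw [if_pos m.2, jacobiTheta₂_term, add_comm]
  · intro m hm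
    by_contra h
    exact hm (if_neg h)

theorem summable_jacobiTheta₂_term_odd (z : ℂ) {τ : ℂ} (hτ : 0 < τ.im) :
    Summable fun m : ℤ => if Odd m then jacobiTheta₂_term m z τ else 0 := by
  refine (((summable_jacobiTheta₂_term_iff z τ).2 hτ).indicator {m : ℤ | Odd m}).congr fun m => ?_
  simp [Set.indicator_apply]

theorem thetaOdd_neg_left (z τ : ℂ) : thetaOdd (-z) τ = thetaOdd z τ := by
  rw [thetaOdd_eq_tsum, thetaOdd_eq_tsum, ← (Equiv.neg ℤ).tsum_eq]
  refine tsum_congr fun m => ?_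
  simp [jacobiTheta₂_term]

/-- The half-period shift multiplies the `m`-th term by `(-1)^m`, so exactly the odd terms change
sign. -/
theorem jacobiTheta₂_add_half (z : ℂ) {τ : ℂ} (hτ : 0 < τ.im) :
    jacobiTheta₂ (z + 1 / 2) τ = jacobiTheta₂ z τ - 2 * thetaOdd z τ := by
  rw [jacobiTheta₂, jacobiTheta₂, thetaOdd_eq_tsum, ← tsum_mul_left,
    ← ((summable_jacobiTheta₂_term_iff z τ).2 hτ).tsum_sub
      ((summable_jacobiTheta₂_term_odd z hτ).mul_left 2)]
  refine tsum_congr fun m => ?_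
  have h : jacobiTheta₂_term m (z + 1 / 2) τ
      = Complex.exp (Real.pi * Complex.I) ^ m * jacobiTheta₂_term m z τ := by
    rw [jacobiTheta₂_term, jacobiTheta₂_term, ← Complex.exp_int_mul, ← Complex.exp_add]
    ring_nf
  rw [h, Complex.exp_pi_mul_I]
  split_ifs with hm
  · rw [hm.neg_one_zpow]; ring
  · rw [(Int.not_odd_iff_even.1 hm).neg_one_zpow]; ring

/-- Here every shift `m q / 2` is an integer, hence a period, and the double series factors. -/
theorem thetaPair_of_even {q : ℕ} (hq : Even q) (w z : ℂ) :
    thetaPair q w z =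
      jacobiTheta₂ w (Complex.I * q / 2) * jacobiTheta₂ z (Complex.I * q / 2) := by
  obtain ⟨r, rfl⟩ := hq
  rw [thetaPair, jacobiTheta₂.eq_1 w, ← tsum_mul_right]
  refine tsum_congr fun m => ?_
  rw [← jacobiTheta₂_add_int z _ (m * r)]
  congr 2
  push_cast
  ring

/-- Modulo integers, `m q / 2` is `0` for even `m` and `1/2` for odd `m`; only the odd `m` pick up
the correction of `jacobiTheta₂_add_half`. -/
theorem thetaPair_of_odd {q : ℕ} (hq : Odd q) (w z : ℂ) :
    thetaPair q w z =
      jacobiTheta₂ w (Complex.I * q / 2) * jacobiTheta₂ z (Complex.I * q / 2)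
        - 2 * (thetaOdd w (Complex.I * q / 2) * thetaOdd z (Complex.I * q / 2)) := by
  have hτ := im_I_mul_div_two_pos hq.pos
  have h1 := ((summable_jacobiTheta₂_term_iff w _).2 hτ).mul_right
    (jacobiTheta₂ z (Complex.I * q / 2))
  have h2 := (summable_jacobiTheta₂_term_odd w hτ).mul_right
    (2 * thetaOdd z (Complex.I * q / 2))
  calc thetaPair q w z = ∑' m : ℤ, (jacobiTheta₂_term m w (Complex.I * q / 2)
          * jacobiTheta₂ z (Complex.I * q / 2)
        - (if Odd m then jacobiTheta₂_term m w (Complex.I * q / 2) else 0)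
          * (2 * thetaOdd z (Complex.I * q / 2))) := by
        refine tsum_congr fun m => ?_
        split_ifs with hm
        · obtain ⟨k, hk⟩ := hm.mul (by exact_mod_cast hq : Odd (q : ℤ))
          have : z + m * q / 2 = z + 1 / 2 + k := by
            have : (m * q : ℂ) = 2 * k + 1 := by exact_mod_cast hk
            rw [this]; ring
          rw [this, jacobiTheta₂_add_int, jacobiTheta₂_add_half z hτ]
          ring
        · obtain ⟨k, hk⟩ := Int.not_odd_iff_even.1 hm
          have : z + m * q / 2 = z + (k * q : ℤ) := by
            rw [hk]; push_cast; ring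
          rw [this, jacobiTheta₂_add_int]
          ring
    _ = _ := by
        rw [h1.tsum_sub h2, tsum_mul_right, tsum_mul_right, ← thetaOdd_eq_tsum,
          ← jacobiTheta₂.eq_1]
        ring

theorem thetaPair_neg {q : ℕ} (w z : ℂ) : thetaPair q (-w) (-z) = thetaPair q w z := by
  rcases Nat.even_or_odd q with h | h
  · simp only [thetaPair_of_even h, jacobiTheta₂_neg_left]
  · simp only [thetaPair_of_odd h, jacobiTheta₂_neg_left, thetaOdd_neg_left]

/-! ### Correlations of the periodized Gaussian as theta values -/

/-- The modular transformation `τ ↦ -1/τ` between `2i/q` and `iq/2`. -/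
theorem jacobiTheta₂_two_I_div {q : ℕ} (hq : 0 < q) (z : ℂ) :
    jacobiTheta₂ z (2 * Complex.I / q) = (Real.sqrt (q / 2) : ℂ)
      * Complex.exp (-(Real.pi * q / 2 * z ^ 2))
      * jacobiTheta₂ (-(Complex.I * q / 2 * z)) (Complex.I * q / 2) := by
  have h0 : (q : ℂ) ≠ 0 := by exact_mod_cast hq.ne'
  have hI := Complex.I_sq
  have h1 : 1 / (-Complex.I * (2 * Complex.I / q)) ^ (1 / 2 : ℂ) = (Real.sqrt (q / 2) : ℂ) := by
    have : -Complex.I * (2 * Complex.I / q) = ((2 / q : ℝ) : ℂ) := by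
      push_cast; field_simp; linear_combination -hI
    rw [this, Real.sqrt_eq_rpow, show (1 / 2 : ℂ) = ((1 / 2 : ℝ) : ℂ) by push_cast; rfl,
      ← Complex.ofReal_cpow (by positivity), show (q / 2 : ℝ) = (2 / q : ℝ)⁻¹ by rw [inv_div],
      Real.inv_rpow (by positivity)]
    push_cast
    rw [one_div]
  rw [jacobiTheta₂_functional_equation, h1]
  have h2 : -Real.pi * Complex.I * z ^ 2 / (2 * Complex.I / q) = -(Real.pi * q / 2 * z ^ 2) := by
    field_simp
  have h3 : z / (2 * Complex.I / q) = -(Complex.I * q / 2 * z) := by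
    field_simp; linear_combination z * hI
  have h4 : -1 / (2 * Complex.I / q) = Complex.I * q / 2 := by
    field_simp; linear_combination -hI
  rw [h2, h3, h4]

/-- Expanding the exponents, the summand is a Gaussian in `s + m q` times a theta term in `a` at `τ
= 2i/q`. After the modular transformation the remaining factor splits into a part free of `m` and
the `m`-th theta term at `iq/2`. -/
theorem tsum_intGaussian_mul {q : ℕ} (hq : 0 < q) (s t m : ℤ) :
    ∑' a : ℤ, Complex.exp (2 * Real.pi * Complex.I * (t * a / q))
        * (intGaussian q a * intGaussian q (a + s + m * q) : ℝ) =
      (Real.sqrt (q / 2) : ℂ) * Complex.exp (-(Real.pi * (s ^ 2 + t ^ 2) / (2 * q)))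
        * Complex.exp (-(Real.pi * Complex.I * s * t / q))
        * (jacobiTheta₂_term m (Complex.I * s / 2 - t / 2) (Complex.I * q / 2)
          * jacobiTheta₂ (s / 2 - Complex.I * t / 2 + m * q / 2) (Complex.I * q / 2)) := by
  have h0 : (q : ℂ) ≠ 0 := by exact_mod_cast hq.ne'
  have hI := Complex.I_sq
  have h1 (a : ℤ) : Complex.exp (2 * Real.pi * Complex.I * (t * a / q))
        * (intGaussian q a * intGaussian q (a + s + m * q) : ℝ) =
      Complex.exp (-(Real.pi * (s + m * q) ^ 2 / q))
        * jacobiTheta₂_term a (t / q + Complex.I * (s + m * q) / q) (2 * Complex.I / q) := by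
    rw [jacobiTheta₂_term, intGaussian, intGaussian]
    push_cast
    rw [← Complex.exp_add, ← Complex.exp_add, ← Complex.exp_add]
    congr 1
    field_simp
    linear_combination (-2 * a * (a + s + m * q)) * hI
  rw [tsum_congr h1, tsum_mul_left, ← jacobiTheta₂.eq_1, jacobiTheta₂_two_I_div hq]
  have h2 : -(Complex.I * q / 2 * (t / q + Complex.I * (s + m * q) / q))
      = s / 2 - Complex.I * t / 2 + m * q / 2 := by
    field_simp; linear_combination (-(s + m * q : ℂ)) * hI
  rw [h2, jacobiTheta₂_term]
  have h3 : Complex.exp (-(Real.pi * (s + m * q) ^ 2 / q))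
      * Complex.exp (-(Real.pi * q / 2 * (t / q + Complex.I * (s + m * q) / q) ^ 2))
      = Complex.exp (-(Real.pi * (s ^ 2 + t ^ 2) / (2 * q)))
        * Complex.exp (-(Real.pi * Complex.I * s * t / q))
        * Complex.exp (2 * Real.pi * Complex.I * m * (Complex.I * s / 2 - t / 2)
          + Real.pi * Complex.I * m ^ 2 * (Complex.I * q / 2)) := by
    rw [← Complex.exp_add, ← Complex.exp_add, ← Complex.exp_add]
    congr 1
    field_simp
    ring_nf
    rw [hI]
    ring
  linear_combination (Real.sqrt (q / 2) : ℂ)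
    * jacobiTheta₂ (s / 2 - Complex.I * t / 2 + m * q / 2) (Complex.I * q / 2) * h3

theorem sum_periodicGaussian_mul {q : ℕ} [NeZero q] (s t : ℤ) :
    ∑ j : Fin q, Complex.exp (2 * Real.pi * Complex.I * (t * (j : ℕ) / q))
        * (periodicGaussian q (j : ℕ) * periodicGaussian q ((j : ℕ) + s) : ℝ) =
      (Real.sqrt (q / 2) : ℂ) * Complex.exp (-(Real.pi * (s ^ 2 + t ^ 2) / (2 * q)))
        * Complex.exp (-(Real.pi * Complex.I * s * t / q))
        * thetaPair q (Complex.I * s / 2 - t / 2) (s / 2 - Complex.I * t / 2) := by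
  have hq : 0 < q := NeZero.pos q
  have h0 : (q : ℂ) ≠ 0 := by exact_mod_cast hq.ne'
  have hn (a : ℤ) : ‖Complex.exp (2 * Real.pi * Complex.I * (t * a / q))‖ = 1 := by
    rw [show 2 * Real.pi * Complex.I * (t * a / q)
      = ((2 * Real.pi * (t * a / q) : ℝ) : ℂ) * Complex.I by push_cast; ring,
      Complex.norm_exp_ofReal_mul_I]
  have hs : Summable (Function.uncurry fun a m : ℤ =>
      Complex.exp (2 * Real.pi * Complex.I * (t * a / q))
        * (intGaussian q a * intGaussian q (a + s + m * q) : ℝ)) := by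
    refine .of_norm_bounded (summable_intGaussian_mul hq s) fun p => ?_
    rw [Function.uncurry_def, norm_mul, hn, one_mul, Complex.norm_real]
    exact (Real.norm_of_nonneg (mul_nonneg (Real.exp_pos _).le (Real.exp_pos _).le)).le
  -- Exchanging the sums puts the sum over `m` inside, where it periodizes the second Gaussian;
  -- splitting `a` into residue classes then periodizes the first.
  rw [thetaPair, ← tsum_mul_left, ← tsum_congr (tsum_intGaussian_mul hq s t), hs.tsum_comm]
  have h1 (a : ℤ) : ∑' m : ℤ, Complex.exp (2 * Real.pi * Complex.I * (t * a / q))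
        * (intGaussian q a * intGaussian q (a + s + m * q) : ℝ) =
      Complex.exp (2 * Real.pi * Complex.I * (t * a / q))
        * (intGaussian q a * periodicGaussian q (a + s) : ℝ) := by
    rw [tsum_mul_left, ← Complex.ofReal_tsum, tsum_mul_left, periodicGaussian]
  have hs' := hs.prod
  simp only [Function.uncurry_apply_pair] at hs'
  simp only [h1] at hs' ⊢
  rw [tsum_int_eq_sum_fin (q := q) hs']
  refine Finset.sum_congr rfl fun j _ => ?_
  have h2 (k : ℤ) : Complex.exp (2 * Real.pi * Complex.I * (t * ((j : ℕ) + k * q : ℤ) / q))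
      = Complex.exp (2 * Real.pi * Complex.I * (t * (j : ℕ) / q)) := by
    rw [Complex.exp_eq_exp_iff_exists_int]
    exact ⟨t * k, by push_cast; field_simp⟩
  have h3 (k : ℤ) : periodicGaussian q ((j : ℕ) + k * q + s) = periodicGaussian q ((j : ℕ) + s) := by
    rw [add_right_comm, periodicGaussian_add]
  simp only [h2, h3]
  rw [tsum_mul_left, ← Complex.ofReal_tsum, tsum_mul_right, periodicGaussian]

/-- The cyclic autocorrelation of the periodized Gaussian. -/
noncomputable def gaussianCorrelation (q : ℕ) (s : ℤ) : ℝ :=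
  ∑ j : Fin q, periodicGaussian q (j : ℕ) * periodicGaussian q ((j : ℕ) + s)

theorem gaussianCorrelation_pos {q : ℕ} [NeZero q] (s : ℤ) : 0 < gaussianCorrelation q s :=
  Finset.sum_pos (fun _ _ => mul_pos (periodicGaussian_pos (NeZero.pos q) _)
    (periodicGaussian_pos (NeZero.pos q) _)) Finset.univ_nonempty

theorem gaussianCorrelation_zero_eq {q : ℕ} [NeZero q] :
    (gaussianCorrelation q 0 : ℂ) = (Real.sqrt (q / 2) : ℂ) * thetaPair q 0 0 := by
  have h := sum_periodicGaussian_mul (q := q) 0 0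
  simpa [gaussianCorrelation] using h

theorem gaussianCorrelation_one_eq {q : ℕ} [NeZero q] :
    (gaussianCorrelation q 1 : ℂ) = (Real.sqrt (q / 2) : ℂ)
      * Complex.exp (-(Real.pi / (2 * q))) * thetaPair q (Complex.I / 2) (1 / 2) := by
  have h := sum_periodicGaussian_mul (q := q) 1 0
  simpa [gaussianCorrelation] using h

/-- This is the Fourier invariance of the test vector: `(s, t) = (0, 1)` and `(1, 0)` give the same
prefactor, and their `thetaPair` arguments differ only by a swap and a common sign, both symmetries
of `thetaPair`. -/
theorem sum_exp_mul_periodicGaussian_sq {q : ℕ} [NeZero q] :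
    ∑ j : Fin q, Complex.exp (2 * Real.pi * Complex.I * ((j : ℕ) / q))
      * (periodicGaussian q (j : ℕ) ^ 2 : ℝ) = gaussianCorrelation q 1 := by
  have h := sum_periodicGaussian_mul (q := q) 0 1
  have hn := thetaPair_neg (q := q) (1 / 2) (Complex.I / 2)
  have hs : thetaPair q (1 / 2) (Complex.I / 2) = thetaPair q (Complex.I / 2) (1 / 2) := by
    rcases Nat.even_or_odd q with h | h
    · simp only [thetaPair_of_even h]; ring
    · simp only [thetaPair_of_odd h]; ring
  rw [gaussianCorrelation_one_eq, ← hs, ← hn]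
  simpa [sq, neg_div] using h

theorem ofReal_sqrt_half_ne_zero {q : ℕ} [NeZero q] : (Real.sqrt (q / 2) : ℂ) ≠ 0 := by
  have : (0 : ℝ) < q := by exact_mod_cast NeZero.pos q
  exact_mod_cast (Real.sqrt_pos.2 (half_pos this)).ne'

theorem thetaPair_zero_ne_zero {q : ℕ} [NeZero q] : thetaPair q 0 0 ≠ 0 := fun h => by
  have h1 := gaussianCorrelation_zero_eq (q := q)
  rw [h, mul_zero] at h1
  exact (gaussianCorrelation_pos (q := q) 0).ne' (by exact_mod_cast h1)

theorem thetaPair_quotient_eq {q : ℕ} [NeZero q] :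
    4 * Complex.exp (-(Real.pi / (2 * q))) * thetaPair q (Complex.I / 2) (1 / 2) / thetaPair q 0 0
      = (4 * gaussianCorrelation q 1 / gaussianCorrelation q 0 : ℝ) := by
  have h0 := thetaPair_zero_ne_zero (q := q)
  have h1 := ofReal_sqrt_half_ne_zero (q := q)
  push_cast
  rw [gaussianCorrelation_zero_eq, gaussianCorrelation_one_eq]
  field_simp

theorem thetaQuotientEven_eq {q : ℕ} [NeZero q] (h : Even q) :
    thetaQuotientEven q = (4 * gaussianCorrelation q 1 / gaussianCorrelation q 0 : ℝ) := by
  rw [← thetaPair_quotient_eq, thetaPair_of_even h, thetaPair_of_even h, thetaQuotientEven, sq]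

theorem thetaQuotientOdd_eq {q : ℕ} [NeZero q] (h : Odd q) :
    thetaQuotientOdd q = (4 * gaussianCorrelation q 1 / gaussianCorrelation q 0 : ℝ) := by
  rw [← thetaPair_quotient_eq, thetaPair_of_odd h, thetaPair_of_odd h, thetaQuotientOdd, sq, sq]

/-! ### Clock and shift operators and the Rayleigh quotient bound -/

/-- The cyclic shift `(U f)(j) = f (j + 1)` on `ℓ²(ℤ/q)`. -/
noncomputable def shiftIsometry (q : ℕ) [NeZero q] :
    EuclideanSpace ℂ (Fin q) ≃ₗᵢ[ℂ] EuclideanSpace ℂ (Fin q) :=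
  LinearIsometryEquiv.piLpCongrLeft 2 ℂ ℂ (Equiv.addRight (1 : Fin q)).symm

theorem shiftIsometry_apply {q : ℕ} [NeZero q] (f : EuclideanSpace ℂ (Fin q)) (j : Fin q) :
    shiftIsometry q f j = f (j + 1) := by
  simp [shiftIsometry, LinearIsometryEquiv.piLpCongrLeft_apply, Equiv.piCongrLeft'_apply]

/-- The root of unity `e^{2π i x}` as a unitary scalar. -/
noncomputable def unitPhase (x : ℝ) : unitary ℂ :=
  ⟨Complex.exp (2 * Real.pi * Complex.I * x), by
    have : ‖Complex.exp (2 * Real.pi * Complex.I * x)‖ = 1 := by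
      rw [show 2 * Real.pi * Complex.I * x = ((2 * Real.pi * x : ℝ) : ℂ) * Complex.I by
        push_cast; ring, Complex.norm_exp_ofReal_mul_I]
    have h : star (Complex.exp (2 * Real.pi * Complex.I * x))
        * Complex.exp (2 * Real.pi * Complex.I * x) = 1 := by
      rw [Complex.star_def, Complex.conj_mul', this]; simp
    exact ⟨h, by rw [mul_comm, h]⟩⟩

/-- The clock operator `(V f)(j) = e^{2π i j / q} f j` on `ℓ²(ℤ/q)`. -/
noncomputable def clockIsometry (q : ℕ) [NeZero q] :
    EuclideanSpace ℂ (Fin q) ≃ₗᵢ[ℂ] EuclideanSpace ℂ (Fin q) :=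
  LinearIsometryEquiv.piLpCongrRight 2 fun j : Fin q =>
    unitPhase ((j : ℕ) / q) • LinearIsometryEquiv.refl ℂ ℂ

theorem clockIsometry_apply {q : ℕ} [NeZero q] (f : EuclideanSpace ℂ (Fin q)) (j : Fin q) :
    clockIsometry q f j = Complex.exp (2 * Real.pi * Complex.I * ((j : ℕ) / q)) * f j := by
  simp only [clockIsometry, LinearIsometryEquiv.piLpCongrRight_apply]
  change Complex.exp (2 * Real.pi * Complex.I * (((j : ℕ) / q : ℝ) : ℂ)) * f j = _
  push_cast
  rfl

theorem Fin.exists_val_add_one {q : ℕ} [NeZero q] (j : Fin q) :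
    ∃ k : ℤ, (((j + 1 : Fin q) : ℕ) : ℤ) = (j : ℕ) + 1 + k * q := by
  have h : ((j + 1 : Fin q) : ℕ) = ((j : ℕ) + 1) % q := by
    rw [Fin.val_add, Fin.val_one', Nat.add_mod_mod]
  -- The quotient is nonzero only at the wraparound `j = q - 1`.
  refine ⟨-(((j : ℕ) + 1) / q : ℤ), ?_⟩
  rw [h, Int.natCast_mod, Int.emod_def]
  push_cast
  ring

theorem isRotationPair_shift_clock (q : ℕ) [NeZero q] :
    IsRotationPair (1 / q : ℝ)
      (shiftIsometry q : EuclideanSpace ℂ (Fin q) →L[ℂ] EuclideanSpace ℂ (Fin q))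
      (clockIsometry q : EuclideanSpace ℂ (Fin q) →L[ℂ] EuclideanSpace ℂ (Fin q)) where
  left_mem := (Unitary.linearIsometryEquiv.symm (shiftIsometry q)).2
  right_mem := (Unitary.linearIsometryEquiv.symm (clockIsometry q)).2
  mul_eq := by
    ext f j
    change shiftIsometry q (clockIsometry q f) j
      = Complex.exp (2 * Real.pi * Complex.I * ((1 / q : ℝ) : ℂ))
        * clockIsometry q (shiftIsometry q f) j
    rw [shiftIsometry_apply, clockIsometry_apply, clockIsometry_apply, shiftIsometry_apply,
      ← mul_assoc, ← Complex.exp_add]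
    congr 1
    obtain ⟨k, hk⟩ := Fin.exists_val_add_one j
    rw [Complex.exp_eq_exp_iff_exists_int]
    have hk' : (((j + 1 : Fin q) : ℕ) : ℂ) = (j : ℕ) + 1 + k * q := by exact_mod_cast hk
    have h0 : (q : ℂ) ≠ 0 := by exact_mod_cast NeZero.ne q
    refine ⟨k, ?_⟩
    rw [hk']
    push_cast
    field_simp
    ring

/-- The numerical range at `x` of `U + U^* + V + V^*` bounds the norm of `H_α` from below. -/
theorem two_mul_re_inner_le_norm_hofstadter {α : ℝ} {E : Type*} [NormedAddCommGroup E]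
    [InnerProductSpace ℂ E] [CompleteSpace E] {U V : E →L[ℂ] E} (h : IsRotationPair α U V)
    (x : E) :
    2 * ((inner ℂ x (U x)).re + (inner ℂ x (V x)).re) ≤ ‖hofstadter α‖ * ‖x‖ ^ 2 := by
  obtain ⟨φ, ⟨hu, hv⟩, -⟩ := RotationAlgebra.existsUnique_lift α h
  have hφ : φ (hofstadter α) = U + star U + V + star V := by
    simp only [hofstadter, map_add, map_star, hu, hv]
  have hle := NonUnitalStarAlgHom.norm_apply_le φ (hofstadter α)
  -- Adjoints have conjugate expectations, so each generator counts twice in the real part.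
  have hadj (T : E →L[ℂ] E) : (inner ℂ x ((star T) x)).re = (inner ℂ x (T x)).re := by
    rw [ContinuousLinearMap.star_eq_adjoint, ContinuousLinearMap.adjoint_inner_right,
      ← inner_conj_symm, Complex.conj_re]
  calc 2 * ((inner ℂ x (U x)).re + (inner ℂ x (V x)).re)
      = (inner ℂ x (φ (hofstadter α) x)).re := by
        rw [hφ]
        simp only [add_apply, inner_add_right, Complex.add_re, hadj]
        ring
    _ ≤ ‖inner ℂ x (φ (hofstadter α) x)‖ := Complex.re_le_norm _
    _ ≤ ‖x‖ * (‖φ (hofstadter α)‖ * ‖x‖) :=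
        (norm_inner_le_norm _ _).trans (by gcongr; exact ContinuousLinearMap.le_opNorm _ _)
    _ ≤ ‖x‖ * (‖hofstadter α‖ * ‖x‖) := by gcongr
    _ = ‖hofstadter α‖ * ‖x‖ ^ 2 := by ring

theorem gaussianCorrelation_quotient_le_norm_hofstadter (q : ℕ) [NeZero q] :
    4 * gaussianCorrelation q 1 / gaussianCorrelation q 0 ≤ ‖hofstadter (1 / q)‖ := by
  let x : EuclideanSpace ℂ (Fin q) := WithLp.toLp 2 fun j => (periodicGaussian q (j : ℕ) : ℂ)
  have hx (j : Fin q) : x j = (periodicGaussian q (j : ℕ) : ℂ) := rfl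
  have h := two_mul_re_inner_le_norm_hofstadter (isRotationPair_shift_clock q) x
  have hU : inner ℂ x (shiftIsometry q x) = (gaussianCorrelation q 1 : ℂ) := by
    rw [PiLp.inner_apply, gaussianCorrelation]
    push_cast
    refine Finset.sum_congr rfl fun j _ => ?_
    obtain ⟨k, hk⟩ := Fin.exists_val_add_one j
    rw [shiftIsometry_apply, hx, hx, hk, periodicGaussian_add]
    simp [mul_comm]
  have hV : inner ℂ x (clockIsometry q x) = (gaussianCorrelation q 1 : ℂ) := by
    rw [PiLp.inner_apply, ← sum_exp_mul_periodicGaussian_sq]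
    refine Finset.sum_congr rfl fun j _ => ?_
    rw [clockIsometry_apply, hx]
    simp
    ring
  have hn : ‖x‖ ^ 2 = gaussianCorrelation q 0 := by
    rw [EuclideanSpace.norm_sq_eq, gaussianCorrelation]
    refine Finset.sum_congr rfl fun j _ => ?_
    simp [hx, sq]
  change 2 * ((inner ℂ x (shiftIsometry q x)).re + (inner ℂ x (clockIsometry q x)).re) ≤ _ at h
  rw [hU, hV, hn, Complex.ofReal_re] at h
  rw [div_le_iff₀ (gaussianCorrelation_pos 0)]
  linarith

/-! ### Equality for `q = 2` -/

/-- At `α = 1/2` the generators and their adjoints anticommute across the pair, so the cross terms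
of the square cancel. -/
theorem norm_add_star_sq_le {B : Type*} [CStarAlgebra B] {U V : B}
    (h : IsRotationPair (1 / 2) U V) : ‖U + star U + V + star V‖ ^ 2 ≤ 8 := by
  have hle {W : B} (hW : W ∈ unitary B) : ‖W + star W‖ ≤ 2 := by
    have : ‖W‖ ≤ 1 := by
      rcases subsingleton_or_nontrivial B with hB | hB
      · simp [Subsingleton.elim W 0]
      · exact (CStarRing.norm_of_mem_unitary hW).le
    calc ‖W + star W‖ ≤ ‖W‖ + ‖star W‖ := norm_add_le _ _
      _ ≤ 2 := by rw [norm_star]; linarith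
  have h1 : U * V + V * U = 0 := by
    have hm := h.mul_eq
    rw [show 2 * Real.pi * Complex.I * ((1 / 2 : ℝ) : ℂ) = Real.pi * Complex.I by push_cast; ring,
      Complex.exp_pi_mul_I, neg_one_smul] at hm
    rw [hm, neg_add_cancel]
  obtain ⟨hU1, hU2⟩ := h.left_mem
  obtain ⟨hV1, hV2⟩ := h.right_mem
  -- Multiplying the relation `h1` by `star V` on both sides transfers it to the adjoint.
  have h2 : U * star V + star V * U = 0 := by
    calc U * star V + star V * U = (star V * V) * (U * star V) + (star V * U) * (V * star V) := by
          rw [hV1, hV2, one_mul, mul_one]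
      _ = star V * (U * V + V * U) * star V := by noncomm_ring
      _ = 0 := by rw [h1]; simp
  have h3 : star U * V + V * star U = 0 := by simpa [add_comm] using congrArg star h2
  have h4 : star U * star V + star V * star U = 0 := by simpa [add_comm] using congrArg star h1
  have hs : star (U + star U + V + star V) * (U + star U + V + star V)
      = (U + star U) * (U + star U) + (V + star V) * (V + star V) := by
    have : star (U + star U + V + star V) = U + star U + V + star V := by
      simp only [star_add, star_star]; abel
    rw [this]
    calc _ = (U + star U) * (U + star U) + (V + star V) * (V + star V) + (U * V + V * U)
          + (U * star V + star V * U) + (star U * V + V * star U)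
          + (star U * star V + star V * star U) := by noncomm_ring
      _ = _ := by rw [h1, h2, h3, h4]; simp
  rw [sq, ← CStarRing.norm_star_mul_self, hs]
  calc _ ≤ ‖U + star U‖ * ‖U + star U‖ + ‖V + star V‖ * ‖V + star V‖ :=
        (norm_add_le _ _).trans (add_le_add (norm_mul_le _ _) (norm_mul_le _ _))
    _ ≤ 2 * 2 + 2 * 2 := by
        gcongr <;> first | exact hle h.left_mem | exact hle h.right_mem
    _ = 8 := by norm_num

/-- With `a, b` the two values of the test vector, `c₀ = a² + b²`, while `c₁` is `2ab` from the
shift and `a² - b²` from the clock; conclude by `(a² + b²)² = (a² - b²)² + (2ab)²`. -/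
theorem gaussianCorrelation_two_sq :
    gaussianCorrelation 2 0 ^ 2 = 2 * gaussianCorrelation 2 1 ^ 2 := by
  have h0 : gaussianCorrelation 2 0 = periodicGaussian 2 0 ^ 2 + periodicGaussian 2 1 ^ 2 := by
    simp [gaussianCorrelation, Fin.sum_univ_two, sq]
  have h1 : gaussianCorrelation 2 1 = 2 * (periodicGaussian 2 0 * periodicGaussian 2 1) := by
    have : periodicGaussian 2 2 = periodicGaussian 2 0 := by
      simpa using periodicGaussian_add (q := 2) 0 1
    simp only [gaussianCorrelation, Fin.sum_univ_two]
    simp [this]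
    ring
  have h2 : gaussianCorrelation 2 1 = periodicGaussian 2 0 ^ 2 - periodicGaussian 2 1 ^ 2 := by
    have h := sum_exp_mul_periodicGaussian_sq (q := 2)
    have he : Complex.exp (2 * Real.pi * Complex.I * 2⁻¹) = -1 := by
      rw [← Complex.exp_pi_mul_I]; congr 1; ring
    simp only [Fin.sum_univ_two] at h
    simp [he] at h
    rw [← Complex.ofReal_inj, ← h]
    push_cast
    ring
  have h3 : gaussianCorrelation 2 0 ^ 2
      = (periodicGaussian 2 0 ^ 2 - periodicGaussian 2 1 ^ 2) ^ 2
        + (2 * (periodicGaussian 2 0 * periodicGaussian 2 1)) ^ 2 := by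
    rw [h0]; ring
  rw [h3, ← h1, ← h2]
  ring

theorem norm_hofstadter_half_le :
    ‖hofstadter (1 / 2)‖ ≤ 4 * gaussianCorrelation 2 1 / gaussianCorrelation 2 0 := by
  have h0 := gaussianCorrelation_pos (q := 2) 0
  have h1 := gaussianCorrelation_pos (q := 2) 1
  have hn := norm_add_star_sq_le (RotationAlgebra.isRotationPair (1 / 2))
  refine le_of_sq_le_sq ?_ (by positivity)
  refine hn.trans ?_
  rw [div_pow, gaussianCorrelation_two_sq, le_div_iff₀ (by positivity)]
  linarith

theorem mainTheorem3 (q : ℕ) (hq : 2 ≤ q) :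
    (Even q →
      jacobiTheta₂ 0 (Complex.I * q / 2) ≠ 0 ∧ jacobiTheta₂ 0 (2 * Complex.I / q) ≠ 0 ∧
      (thetaQuotientEven q).im = 0 ∧
      thetaQuotientEven q =
        4 * (jacobiTheta₂ (1 / q) (2 * Complex.I / q) * jacobiTheta₂ (1 / 2) (Complex.I * q / 2))
          / (jacobiTheta₂ 0 (2 * Complex.I / q) * jacobiTheta₂ 0 (Complex.I * q / 2)) ∧
      (thetaQuotientEven q).re ≤ ‖hofstadter (1 / q)‖) ∧
    (Odd q →
      jacobiTheta₂ 0 (Complex.I * q / 2) ^ 2 - 2 * thetaOdd 0 (Complex.I * q / 2) ^ 2 ≠ 0 ∧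
      (thetaQuotientOdd q).im = 0 ∧
      (thetaQuotientOdd q).re ≤ ‖hofstadter (1 / q)‖) ∧
    (q = 2 → (thetaQuotientEven q).re = ‖hofstadter (1 / q)‖) := by
  have : NeZero q := ⟨by omega⟩
  have h0 : (q : ℂ) ≠ 0 := by exact_mod_cast NeZero.ne q
  have hle := gaussianCorrelation_quotient_le_norm_hofstadter q
  have hne := thetaPair_zero_ne_zero (q := q)
  refine ⟨fun h => ?_, fun h => ?_, ?_⟩
  · rw [thetaPair_of_even h] at hne
    have hθ := left_ne_zero_of_mul hne
    have hs := ofReal_sqrt_half_ne_zero (q := q)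
    -- Both theta values at `2i/q` carry the factor `√(q/2)`, which cancels in the quotient; the one
    -- at `1/q` also supplies `e^{-π/(2q)}`.
    have hT : jacobiTheta₂ 0 (2 * Complex.I / q)
        = (Real.sqrt (q / 2) : ℂ) * jacobiTheta₂ 0 (Complex.I * q / 2) := by
      simpa using jacobiTheta₂_two_I_div (NeZero.pos q) 0
    have hT' : jacobiTheta₂ (1 / q) (2 * Complex.I / q) = (Real.sqrt (q / 2) : ℂ)
        * Complex.exp (-(Real.pi / (2 * q)))
        * jacobiTheta₂ (Complex.I / 2) (Complex.I * q / 2) := by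
      rw [jacobiTheta₂_two_I_div (NeZero.pos q), jacobiTheta₂_neg_left]
      have h1 : Real.pi * q / 2 * (1 / q) ^ 2 = (Real.pi / (2 * q) : ℂ) := by field_simp
      have h2 : Complex.I * q / 2 * (1 / q) = Complex.I / 2 := by field_simp
      rw [h1, h2]
    refine ⟨hθ, hT ▸ mul_ne_zero hs hθ, ?_, ?_, ?_⟩
    · rw [thetaQuotientEven_eq h, Complex.ofReal_im]
    · rw [thetaQuotientEven, hT, hT']
      field_simp
    · rwa [thetaQuotientEven_eq h, Complex.ofReal_re]
  · rw [thetaPair_of_odd h, ← sq, ← sq] at hne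
    refine ⟨hne, ?_, ?_⟩
    · rw [thetaQuotientOdd_eq h, Complex.ofReal_im]
    · rwa [thetaQuotientOdd_eq h, Complex.ofReal_re]
  · rintro rfl
    rw [thetaQuotientEven_eq even_two, Complex.ofReal_re]
    exact le_antisymm hle (by exact_mod_cast norm_hofstadter_half_le)
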